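/- Let $K$ be a field of characteristic $0$ (for example $\mathbb{R}$ or $\mathbb{C}$) and let $d\ge 3$. For $\mu,s\in K$ define the moments $m_i(\mu,s)\in K$ of the univariate Gaussian with mean $\mu$ and variance $s=\sigma^2$ by $$\sum_{i\ge 0}\frac{m_i(\mu,s)}{i!}\,t^i=\exp(\mu t)\cdot\exp\left(\tfrac12 s t^2\right),$$ and let the Gaussian moment surface $\mathcal{G}_{1,d}\subset\mathbb{P}^d$ be the Zariski closure of the set of all points $(m_0(\mu,s):m_1(\mu,s):\cdots:m_d(\mu,s))$ with $\mu,s\in K$. Let $I_d\subset K[m_0,\ldots,m_d]$ be its homogeneous vanishing ideal and let $$H_d=\begin{pmatrix}0&m_0&2m_1&3m_2&\cdots&(d-1)m_{d-2}\\ m_0&m_1&m_2&m_3&\cdots&m_{d-1}\\ m_1&m_2&m_3&m_4&\cdots&m_d\end{pmatrix}.$$ Then $I_d$ is a prime ideal and the $3\times 3$-minors of $H_d$ form a Gröbner basis of $I_d$ with respect to the (graded) reverse lexicographic order, both for the ordering $m_0>m_1>\cdots>m_d$ and for the ordering $m_d>\cdots>m_1>m_0$ of the variables. Moreover, for both of these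 orders, the initial ideal is $$\mathrm{in}(I_d)=\langle m_1,m_2,\ldots,m_{d-2}\rangle^3 .$$ -/

import Mathlib

/-! ### The graded reverse lexicographic order -/

/-- Exponent vectors in the variables `σ`, to be ordered by the graded reverse lexicographic order
in which the variables are listed from the largest to the smallest as
`e.symm 0 > e.symm 1 > ⋯ > e.symm (n - 1)`. -/
def DegRevLex {σ : Type} {n : ℕ} (_e : σ ≃ Fin n) : Type := σ →₀ ℕ

namespace DegRevLex

noncomputable instance {σ : Type} {n : ℕ} (e : σ ≃ Fin n) : AddCommMonoid (DegRevLex e) :=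
  inferInstanceAs (AddCommMonoid (σ →₀ ℕ))

/-- The identity, from exponent vectors to the ordered type. -/
noncomputable def ofExp {σ : Type} {n : ℕ} (e : σ ≃ Fin n) : (σ →₀ ℕ) ≃+ DegRevLex e :=
  AddEquiv.refl (σ →₀ ℕ)

/-- Total degree first; ties are broken by the reversed colexicographic order. -/
noncomputable def key {σ : Type} {n : ℕ} (e : σ ≃ Fin n) (a : DegRevLex e) :
    ℕ ×ₗ (Colex (Fin n →₀ ℕ))ᵒᵈ :=
  toLex (((ofExp e).symm a).degree,
    OrderDual.toDual (toColex (Finsupp.equivMapDomain e ((ofExp e).symm a))))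

theorem key_injective {σ : Type} {n : ℕ} (e : σ ≃ Fin n) : Function.Injective (key e) := by
  intro a b h
  have h2 : Finsupp.equivMapDomain e ((ofExp e).symm a)
      = Finsupp.equivMapDomain e ((ofExp e).symm b) := congrArg (fun x => (ofLex x).2) h
  exact (ofExp e).symm.injective ((Finsupp.equivCongrLeft e).injective h2)

noncomputable instance {σ : Type} {n : ℕ} (e : σ ≃ Fin n) : LinearOrder (DegRevLex e) :=
  LinearOrder.lift' (key e) (key_injective e)

theorem lt_iff {σ : Type} {n : ℕ} (e : σ ≃ Fin n) (a b : σ →₀ ℕ) :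
    ofExp e a < ofExp e b ↔ a.degree < b.degree ∨ (a.degree = b.degree ∧
      ∃ i, (∀ j, e i < e j → a j = b j) ∧ b i < a i) := by
  change key e (ofExp e a) < key e (ofExp e b) ↔ _
  rw [key, key, Prod.Lex.toLex_lt_toLex]
  simp only [AddEquiv.symm_apply_apply, OrderDual.toDual_lt_toDual, Finsupp.Colex.lt_iff,
    ofColex_toColex, Finsupp.equivMapDomain_apply]
  refine or_congr Iff.rfl (and_congr Iff.rfl ⟨?_, ?_⟩)
  · rintro ⟨i, hi, h⟩
    refine ⟨e.symm i, fun j hj => ?_, h⟩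
    simpa using (hi (e j) (by simpa using hj)).symm
  · rintro ⟨i, hi, h⟩
    refine ⟨e i, fun j hj => ?_, by simpa using h⟩
    exact (hi (e.symm j) (by simpa using hj)).symm

theorem add_lt_add_left' {σ : Type} {n : ℕ} (e : σ ≃ Fin n) (a b c : σ →₀ ℕ)
    (h : ofExp e a < ofExp e b) : ofExp e (a + c) < ofExp e (b + c) := by
  rw [lt_iff] at h ⊢
  simpa using h

instance {σ : Type} {n : ℕ} (e : σ ≃ Fin n) : IsOrderedAddMonoid (DegRevLex e) where
  add_le_add_left a b h c := by
    rcases h.eq_or_lt with rfl | h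
    · exact le_rfl
    · exact (add_lt_add_left' e a b c h).le

theorem ofExp_monotone {σ : Type} {n : ℕ} (e : σ ≃ Fin n) : Monotone (ofExp e) := by
  intro a b h
  rcases h.eq_or_lt with rfl | h'
  · exact le_rfl
  · refine le_of_lt ((lt_iff e a b).2 (Or.inl ?_))
    obtain ⟨c, rfl⟩ := exists_add_of_le h
    have hc : c ≠ 0 := by rintro rfl; simp at h'
    have : c.degree ≠ 0 := fun h0 => hc ((Finsupp.degree_eq_zero_iff c).1 h0)
    rw [map_add]
    omega

instance {σ : Type} {n : ℕ} (e : σ ≃ Fin n) : WellFoundedLT (DegRevLex e) := by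
  have : Finite σ := Finite.of_equiv _ e.symm
  have : WellQuasiOrderedLE (DegRevLex e) := ⟨fun f => by
    obtain ⟨i, j, hij, h⟩ := (Finsupp.wellQuasiOrderedLE (α := ℕ) (σ := σ)).wqo
      (fun k => (ofExp e).symm (f k))
    exact ⟨i, j, hij, by simpa using ofExp_monotone e h⟩⟩
  infer_instance

end DegRevLex

/-- The graded reverse lexicographic monomial order with
`e.symm 0 > e.symm 1 > ⋯ > e.symm (n - 1)`. -/
noncomputable def degRevLex {σ : Type} {n : ℕ} (e : σ ≃ Fin n) : MonomialOrder σ where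
  syn := DegRevLex e
  toSyn := DegRevLex.ofExp e
  toSyn_monotone := DegRevLex.ofExp_monotone e

/-! ### Initial ideals and Gröbner bases -/

/-- The initial ideal: the ideal generated by the leading terms of all elements of `I`. -/
noncomputable def initialIdeal {σ K : Type*} [Field K] (mo : MonomialOrder σ)
    (I : Ideal (MvPolynomial σ K)) : Ideal (MvPolynomial σ K) :=
  Ideal.span (mo.leadingTerm '' (I : Set (MvPolynomial σ K)))

/-- `G` is a Gröbner basis of `I`: a finite subset of `I` whose leading terms generate the initial
ideal of `I`. -/
def IsGroebnerBasis {σ K : Type*} [Field K] (mo : MonomialOrder σ)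
    (G : Set (MvPolynomial σ K)) (I : Ideal (MvPolynomial σ K)) : Prop :=
  G.Finite ∧ G ⊆ (I : Set (MvPolynomial σ K)) ∧
    Ideal.span (mo.leadingTerm '' G) = initialIdeal mo I

/-! ### Projective varieties -/

/-- The affine cone (without the origin) over a set of points of projective space. -/
def affineCone {ι K : Type*} [Field K] (V : Set (Projectivization K (ι → K))) : Set (ι → K) :=
  {v | ∃ hv : v ≠ 0, Projectivization.mk K v hv ∈ V}

/-- The ideal of a set of points of projective space: the polynomials that vanish at all homogeneous
coordinate vectors of all the points. -/
noncomputable def projIdeal {ι K : Type*} [Field K] (V : Set (Projectivization K (ι → K))) :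
    Ideal (MvPolynomial ι K) :=
  MvPolynomial.vanishingIdeal K (affineCone V)

/-- The Zariski closure in projective space. -/
def projClosure {ι K : Type*} [Field K] (V : Set (Projectivization K (ι → K))) :
    Set (Projectivization K (ι → K)) :=
  {p | ∀ f ∈ projIdeal V, ∀ (v : ι → K) (hv : v ≠ 0), Projectivization.mk K v hv = p →
    MvPolynomial.eval v f = 0}

/-! ### The Gaussian moment variety -/

/-- The moment generating function `exp (μ t) * exp (s t² / 2)` of the univariate Gaussian with mean
`μ` and variance `s`, as a formal power series in `t`. -/
noncomputable def gaussianMGF {K : Type*} [Field K] [CharZero K] (μ s : K) : PowerSeries K :=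
  PowerSeries.rescale μ (PowerSeries.exp K) *
    (PowerSeries.rescale (s / 2) (PowerSeries.exp K)).subst (PowerSeries.X ^ 2 : PowerSeries K)

/-- The `i`-th moment `mᵢ`, where `∑ mᵢ tⁱ / i!` is the moment generating function. -/
noncomputable def gaussianMoment {K : Type*} [Field K] [CharZero K] (μ s : K) (i : ℕ) : K :=
  (i.factorial : K) * PowerSeries.coeff i (gaussianMGF μ s)

theorem gaussianMoment_zero {K : Type*} [Field K] [CharZero K] (μ s : K) :
    gaussianMoment μ s 0 = 1 := by
  have h (a : K) : PowerSeries.constantCoeff (PowerSeries.rescale a (PowerSeries.exp K)) = 1 := by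
    rw [← PowerSeries.coeff_zero_eq_constantCoeff_apply, PowerSeries.coeff_rescale]
    simp
  simp [gaussianMoment, gaussianMGF, PowerSeries.constantCoeff_subst_X_pow, h]

/-- The vector `(m₀, m₁, …, m_d)` of moments. -/
noncomputable def gaussianMomentVector {K : Type*} [Field K] [CharZero K] (d : ℕ) (μ s : K) :
    Fin (d + 1) → K :=
  fun i => gaussianMoment μ s i

theorem gaussianMomentVector_ne_zero {K : Type*} [Field K] [CharZero K] (d : ℕ) (μ s : K) :
    gaussianMomentVector d μ s ≠ 0 := fun h => by
  have h0 := congrFun h 0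
  simp [gaussianMomentVector, gaussianMoment_zero] at h0

/-- The Gaussian moment variety of order `d`: the Zariski closure in projective `d`-space of the set
of points `(m₀ : m₁ : ⋯ : m_d)` for all values of the parameters mean and variance. -/
noncomputable def gaussianMomentVariety (K : Type*) [Field K] [CharZero K] (d : ℕ) :
    Set (Projectivization K (Fin (d + 1) → K)) :=
  projClosure (Set.range fun θ : K × K =>
    Projectivization.mk K (gaussianMomentVector d θ.1 θ.2)
      (gaussianMomentVector_ne_zero d θ.1 θ.2))

/-! ### The determinantal presentation -/

/-- The `3 × d` matrix whose column `j = 0, …, d - 1` is `(j m_{j-1}, m_j, m_{j+1})`; the top entry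
of column `0` is `0`. -/
noncomputable def momentMatrix (K : Type*) [Field K] (d : ℕ) :
    Matrix (Fin 3) (Fin d) (MvPolynomial (Fin (d + 1)) K) :=
  Matrix.of
    ![fun j => ((j : ℕ) : MvPolynomial (Fin (d + 1)) K) *
        MvPolynomial.X ⟨(j : ℕ) - 1, by omega⟩,
      fun j => MvPolynomial.X j.castSucc,
      fun j => MvPolynomial.X j.succ]

/-- The set of `3 × 3` minors, one for each choice of three columns. -/
noncomputable def momentMinors (K : Type*) [Field K] (d : ℕ) :
    Set (MvPolynomial (Fin (d + 1)) K) :=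
  Set.range fun c : Fin 3 ↪o Fin d => ((momentMatrix K d).submatrix id c).det

/-! The generating function G satisfies G' = (μ + s t) G, so m_{n+1} = μ m_n + n s m_{n-1}. Hence on
the cone over the surface the last row of H_d is a combination of the other two, and the minors
vanish. The ideal is the kernel of a map into a domain (`coneHom`), so it is prime.

All that is used of the two orders is that m_i m_l < m_j m_k whenever i < j ≤ k < l (`IsBalanced`).
This makes m_{a+1} m_b m_{c-1} the leading monomial of the minor on columns a < b < c, and these are
exactly the cubic monomials in m_1, …, m_{d-2}. So the cube of ⟨m_1, …, m_{d-2}⟩ lies in the initial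
ideal.

The reverse inclusion is a count. Call a monomial standard if its degree in m_1, …, m_{d-2} is at
most 2. After setting m_0 = 1 these are the m_{d-1}^b m_d^c m_i m_j with 0 ≤ i ≤ j ≤ d-2. Giving m_i
weight i, their generating function is the Gaussian binomial [d choose 2] divided by
(1-t^{d-1})(1-t^d), that is 1/((1-t)(1-t²)), the one for a polynomial ring in variables of weights 1
and 2. Only the inequality is needed (`exists_injective_weight`). Reduction by the minors shows that
the images of the standard monomials span that ring, weight by weight (`monomial_mem_span_std`), so
they are linearly independent (`linearIndependent_std`), and no standard monomial can lead an
element of the ideal (`IsBalanced.three_le_midDegree`). -/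

/-! ### Gaussian moments as polynomials -/

/-- The moments of a Gaussian as polynomials in the first moment `X 0` and the second moment
`X 1`. -/
noncomputable def momentPoly (K : Type*) [Field K] : ℕ → MvPolynomial (Fin 2) K
  | 0 => 1
  | 1 => MvPolynomial.X 0
  | n + 2 => MvPolynomial.X 0 * momentPoly K (n + 1) +
      ((n + 1 : ℕ) : MvPolynomial (Fin 2) K) * (MvPolynomial.X 1 - MvPolynomial.X 0 ^ 2) *
        momentPoly K n

/-- The reason for taking the first two moments as parameters instead of mean and variance: every
monomial in the parameters is then the image of a monomial m_1^p m_2^q. -/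
theorem momentPoly_two (K : Type*) [Field K] : momentPoly K 2 = MvPolynomial.X 1 := by
  simp only [momentPoly]
  push_cast
  ring

theorem momentPoly_succ (K : Type*) [Field K] (n : ℕ) :
    momentPoly K (n + 1) = MvPolynomial.X 0 * momentPoly K n +
      (n : MvPolynomial (Fin 2) K) * (MvPolynomial.X 1 - MvPolynomial.X 0 ^ 2) *
        momentPoly K (n - 1) := by
  cases n with
  | zero => simp [momentPoly]
  | succ n => rfl

/-! ### The moment recurrence, from the differential equation of the generating function -/

section Recurrence

variable {K : Type*} [Field K] [CharZero K]

open PowerSeries in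
theorem derivative_rescale_exp (μ : K) :
    derivative K (rescale μ (exp K)) = C μ * rescale μ (exp K) := by
  ext n
  have h : (n.factorial : K) ≠ 0 := by exact_mod_cast n.factorial_ne_zero
  have h' : (n : K) + 1 ≠ 0 := by exact_mod_cast n.succ_ne_zero
  simp only [coeff_derivative, coeff_C_mul, coeff_rescale, coeff_exp, Nat.factorial_succ]
  simp
  field_simp
  ring

open PowerSeries in
theorem derivative_subst_rescale_exp (s : K) :
    derivative K ((rescale (s / 2) (exp K)).subst (X ^ 2 : PowerSeries K)) =
      C s * (X * (rescale (s / 2) (exp K)).subst (X ^ 2 : PowerSeries K)) := by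
  ext n
  rw [coeff_derivative, coeff_C_mul]
  cases n with
  | zero => simp [coeff_subst_X_pow]
  | succ n =>
    rw [coeff_succ_X_mul, coeff_subst_X_pow two_ne_zero, coeff_subst_X_pow two_ne_zero]
    by_cases hn : 2 ∣ n
    · obtain ⟨k, rfl⟩ := hn
      have h : (k.factorial : K) ≠ 0 := by exact_mod_cast k.factorial_ne_zero
      have h' : (k : K) + 1 ≠ 0 := by exact_mod_cast k.succ_ne_zero
      have e : (2 * k + 1 + 1) / 2 = k + 1 := by omega
      rw [if_pos (by omega), if_pos (by omega), e, Nat.mul_div_cancel_left _ two_pos]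
      simp only [coeff_rescale, coeff_exp, Nat.factorial_succ]
      simp
      field_simp
      ring
    · rw [if_neg (by omega), if_neg hn]
      simp

open PowerSeries in
theorem derivative_gaussianMGF (μ s : K) :
    derivative K (gaussianMGF μ s) = C μ * gaussianMGF μ s + C s * (X * gaussianMGF μ s) := by
  rw [gaussianMGF, Derivation.leibniz, derivative_rescale_exp, derivative_subst_rescale_exp]
  simp only [smul_eq_mul]
  ring

theorem gaussianMoment_one (μ s : K) : gaussianMoment μ s 1 = μ := by
  have h := congrArg (PowerSeries.coeff 0) (derivative_gaussianMGF μ s)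
  have h0 := gaussianMoment_zero μ s
  simp only [gaussianMoment, Nat.factorial_zero, Nat.cast_one, one_mul] at h0
  rw [PowerSeries.coeff_derivative, map_add, PowerSeries.coeff_C_mul, h0] at h
  simpa [gaussianMoment] using h

theorem gaussianMoment_add_two (μ s : K) (n : ℕ) :
    gaussianMoment μ s (n + 2) =
      μ * gaussianMoment μ s (n + 1) + (n + 1) * s * gaussianMoment μ s n := by
  have h := congrArg (PowerSeries.coeff (n + 1)) (derivative_gaussianMGF μ s)
  rw [PowerSeries.coeff_derivative, map_add, PowerSeries.coeff_C_mul, PowerSeries.coeff_C_mul,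
    PowerSeries.coeff_succ_X_mul] at h
  simp only [gaussianMoment, Nat.factorial_succ]
  push_cast at h ⊢
  linear_combination ((n : K) + 1) * (n.factorial : K) * h

theorem eval_momentPoly (μ s : K) (n : ℕ) :
    MvPolynomial.eval ![μ, μ ^ 2 + s] (momentPoly K n) = gaussianMoment μ s n := by
  induction n using Nat.twoStepInduction with
  | zero => simp [momentPoly, gaussianMoment_zero]
  | one => simp [momentPoly, gaussianMoment_one]
  | more n h₀ h₁ =>
    rw [gaussianMoment_add_two, ← h₀, ← h₁, momentPoly]
    simp

end Recurrence

/-! ### The ideal as a kernel -/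

/-- The substitution of the moments for the variables. -/
noncomputable def momentHom (K : Type*) [Field K] (d : ℕ) :
    MvPolynomial (Fin (d + 1)) K →ₐ[K] MvPolynomial (Fin 2) K :=
  MvPolynomial.aeval fun i => momentPoly K i

/-- The parametrization of the affine cone over the moment surface. -/
noncomputable def coneHom (K : Type*) [Field K] (d : ℕ) :
    MvPolynomial (Fin (d + 1)) K →ₐ[K] Polynomial (MvPolynomial (Fin 2) K) :=
  MvPolynomial.aeval fun i => Polynomial.C (momentPoly K i) * Polynomial.X

theorem coneHom_monomial (K : Type*) [Field K] (d : ℕ) (a : Fin (d + 1) →₀ ℕ) (r : K) :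
    coneHom K d (MvPolynomial.monomial a r) =
      Polynomial.monomial a.degree (momentHom K d (MvPolynomial.monomial a r)) := by
  simp only [coneHom, momentHom, MvPolynomial.aeval_monomial, mul_pow, Finsupp.prod_mul]
  rw [← Polynomial.C_mul_X_pow_eq_monomial, Finsupp.degree_apply]
  simp only [Finsupp.prod, Finset.prod_pow_eq_pow_sum, map_mul, map_prod, map_pow, ← mul_assoc]
  rfl

/-- The extra variable records the degree, so `coneHom` kills a polynomial exactly when `momentHom`
kills each of its homogeneous components. -/
theorem coeff_coneHom (K : Type*) [Field K] (d n : ℕ) (f : MvPolynomial (Fin (d + 1)) K) :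
    (coneHom K d f).coeff n = momentHom K d (MvPolynomial.homogeneousComponent n f) := by
  classical
  induction f using MvPolynomial.induction_on' with
  | monomial a r =>
    rw [coneHom_monomial, Polynomial.coeff_monomial, MvPolynomial.homogeneousComponent_apply,
      Finset.sum_filter]
    by_cases hr : r = 0
    · simp [hr]
    · rw [MvPolynomial.support_monomial, if_neg hr, Finset.sum_singleton]
      split_ifs <;> simp
  | add p q hp hq => simp [hp, hq]

theorem eval_coneHom {K : Type*} [Field K] [CharZero K] (d : ℕ) (μ s t : K)
    (f : MvPolynomial (Fin (d + 1)) K) :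
    MvPolynomial.eval ![μ, μ ^ 2 + s] ((coneHom K d f).eval (MvPolynomial.C t)) =
      MvPolynomial.eval (t • gaussianMomentVector d μ s) f := by
  induction f using MvPolynomial.induction_on with
  | C r => simp [coneHom]
  | add p q hp hq => simp [hp, hq]
  | mul_X p i hp =>
    rw [map_mul, Polynomial.eval_mul, map_mul, hp, map_mul]
    simp [coneHom, eval_momentPoly, gaussianMomentVector, mul_comm t]

theorem coneHom_eq_zero_iff {K : Type*} [Field K] [CharZero K] (d : ℕ)
    (f : MvPolynomial (Fin (d + 1)) K) :
    coneHom K d f = 0 ↔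
      ∀ t μ s : K, t ≠ 0 → MvPolynomial.eval (t • gaussianMomentVector d μ s) f = 0 := by
  constructor
  · intro h t μ s _
    rw [← eval_coneHom, h]
    simp
  · intro h
    have key : ∀ t : K, t ≠ 0 → (coneHom K d f).eval (MvPolynomial.C t) = 0 := by
      intro t ht
      refine MvPolynomial.funext fun x => ?_
      -- The map (μ, s) ↦ (μ, μ² + s) is onto K², so vanishing at all Gaussian parameters is
      -- vanishing at every point.
      have hx : x = ![x 0, x 0 ^ 2 + (x 1 - x 0 ^ 2)] := by
        ext i; fin_cases i <;> simp
      rw [hx, eval_coneHom, h t _ _ ht, map_zero]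
    refine Polynomial.eq_zero_of_infinite_isRoot _ (Set.Infinite.mono
      (s := MvPolynomial.C '' {t : K | t ≠ 0}) ?_ ?_)
    · rintro _ ⟨t, ht, rfl⟩
      exact key t ht
    · refine Set.Infinite.image (MvPolynomial.C_injective _ _).injOn ?_
      exact (Set.finite_singleton (0 : K)).infinite_compl

/-! ### The vanishing ideal of the surface and its primality -/

theorem projIdeal_projClosure {ι K : Type*} [Field K] (V : Set (Projectivization K (ι → K))) :
    projIdeal (projClosure V) = projIdeal V := by
  refine le_antisymm ?_ ?_
  · refine MvPolynomial.vanishingIdeal_anti_mono ?_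
    rintro v ⟨hv, hV⟩
    refine ⟨hv, fun f hf w hw hwv => ?_⟩
    exact hf w ⟨hw, hwv ▸ hV⟩
  · rintro f hf v ⟨hv, hV⟩
    exact hV f hf v hv rfl

theorem mem_projIdeal_gaussianMomentVariety {K : Type*} [Field K] [CharZero K] (d : ℕ)
    (f : MvPolynomial (Fin (d + 1)) K) :
    f ∈ projIdeal (gaussianMomentVariety K d) ↔ coneHom K d f = 0 := by
  rw [gaussianMomentVariety, projIdeal_projClosure, coneHom_eq_zero_iff]
  constructor
  · intro h t μ s ht
    have hne : t • gaussianMomentVector d μ s ≠ 0 :=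
      smul_ne_zero ht (gaussianMomentVector_ne_zero d μ s)
    refine h _ ⟨hne, (μ, s), ?_⟩
    rw [Projectivization.mk_eq_mk_iff']
    exact ⟨t⁻¹, by rw [smul_smul, inv_mul_cancel₀ ht, one_smul]⟩
  · rintro h v ⟨hv, ⟨μ, s⟩, hV⟩
    rw [Projectivization.mk_eq_mk_iff'] at hV
    obtain ⟨t, ht⟩ := hV
    have ht0 : t ≠ 0 := by
      rintro rfl
      exact gaussianMomentVector_ne_zero d μ s (by simpa using ht.symm)
    have := h t⁻¹ μ s (inv_ne_zero ht0)
    rwa [← ht, smul_smul, inv_mul_cancel₀ ht0, one_smul] at this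

theorem isPrime_projIdeal_gaussianMomentVariety (K : Type*) [Field K] [CharZero K] (d : ℕ) :
    (projIdeal (gaussianMomentVariety K d)).IsPrime := by
  have : projIdeal (gaussianMomentVariety K d) = RingHom.ker (coneHom K d) := by
    ext f
    rw [mem_projIdeal_gaussianMomentVariety, RingHom.mem_ker]
  rw [this]
  exact RingHom.ker_isPrime _

/-! ### Counting standard monomials -/

/-- The tuples `(b, c, i, j)` with `i ≤ j ≤ d - 2`, which stand for the standard monomials
`m_{d-1}^b m_d^c m_i m_j`. -/
abbrev StdIndex (d : ℕ) : Type := {q : ℕ × ℕ × ℕ × ℕ // q.2.2.1 ≤ q.2.2.2 ∧ q.2.2.2 + 2 ≤ d}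

/-- The weight of `m_{d-1}^b m_d^c m_i m_j`, where `m_i` has weight `i`. -/
def StdIndex.wt {d : ℕ} (q : StdIndex d) : ℕ :=
  q.1.1 * (d - 1) + q.1.2.1 * d + q.1.2.2.1 + q.1.2.2.2

theorem mul_add_left_inj_of_lt {n x y b c : ℕ} (hx : x < n) (hy : y < n)
    (h : x + n * b = y + n * c) : x = y ∧ b = c := by
  have h1 := congrArg (· % n) h
  simp only [Nat.add_mul_mod_self_left, Nat.mod_eq_of_lt hx, Nat.mod_eq_of_lt hy] at h1
  subst h1
  exact ⟨rfl, Nat.eq_of_mul_eq_mul_left (by omega) (Nat.add_left_cancel h)⟩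

/-- There is an injection from the standard monomials to the monomials in a variable of weight one
and a variable of weight two that preserves weights. -/
theorem exists_injective_weight (d : ℕ) (hd : 2 ≤ d) :
    ∃ F : StdIndex d → ℕ × ℕ, Function.Injective F ∧ ∀ q, (F q).1 + 2 * (F q).2 = q.wt := by
  obtain ⟨h, rfl | rfl⟩ : ∃ h, d = 2 * h + 2 ∨ d = 2 * h + 3 := ⟨(d - 2) / 2, by omega⟩
  -- The odd one of d - 1 and d is the modulus for the first exponent, half of the even one for the
  -- second. It remains to send the pairs i ≤ j ≤ 2h to residues r < 2h + 1, s < h + 1 with r + 2s =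
  -- i + j. The two cases cannot collide: r + s = j ≤ 2h if i ≤ h, and r + s = h + i > 2h otherwise.
  · refine ⟨fun q => ((if q.1.2.2.1 ≤ h then q.1.2.2.2 - q.1.2.2.1
        else 2 * h + q.1.2.2.1 - q.1.2.2.2) + (2 * h + 1) * q.1.1,
        (if q.1.2.2.1 ≤ h then q.1.2.2.1 else q.1.2.2.2 - h) + (h + 1) * q.1.2.1), ?_, ?_⟩
    · rintro ⟨⟨b, c, i, j⟩, hij, hj⟩ ⟨⟨b', c', i', j'⟩, hij', hj'⟩ heq
      simp only [Prod.mk.injEq] at heq hij hj hij' hj'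
      obtain ⟨h1, h2⟩ := heq
      obtain ⟨h1, rfl⟩ := mul_add_left_inj_of_lt (by split_ifs <;> omega)
        (by split_ifs <;> omega) h1
      obtain ⟨h2, rfl⟩ := mul_add_left_inj_of_lt (by split_ifs <;> omega)
        (by split_ifs <;> omega) h2
      simp only [Subtype.mk.injEq, Prod.mk.injEq, true_and]
      split_ifs at h1 h2 <;> omega
    · rintro ⟨⟨b, c, i, j⟩, hij, hj⟩
      dsimp only at hij hj
      simp only [StdIndex.wt]
      have e1 : b * (2 * h + 2 - 1) = (2 * h + 1) * b := by
        rw [mul_comm]; congr 1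
      have e2 : c * (2 * h + 2) = 2 * ((h + 1) * c) := by ring
      rw [e1, e2]
      split_ifs <;> omega
  -- Now d is the odd one, so b and c exchange roles; the cases are separated by r + s ≤ 2h + 1.
  · refine ⟨fun q => ((if q.1.2.2.1 ≤ h then q.1.2.2.2 - q.1.2.2.1
        else 2 * h + 2 + q.1.2.2.1 - q.1.2.2.2) + (2 * h + 3) * q.1.2.1,
        (if q.1.2.2.1 ≤ h then q.1.2.2.1 else q.1.2.2.2 - h - 1) + (h + 1) * q.1.1), ?_, ?_⟩
    · rintro ⟨⟨b, c, i, j⟩, hij, hj⟩ ⟨⟨b', c', i', j'⟩, hij', hj'⟩ heq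
      simp only [Prod.mk.injEq] at heq hij hj hij' hj'
      obtain ⟨h1, h2⟩ := heq
      obtain ⟨h1, rfl⟩ := mul_add_left_inj_of_lt (by split_ifs <;> omega)
        (by split_ifs <;> omega) h1
      obtain ⟨h2, rfl⟩ := mul_add_left_inj_of_lt (by split_ifs <;> omega)
        (by split_ifs <;> omega) h2
      simp only [Subtype.mk.injEq, Prod.mk.injEq, true_and]
      split_ifs at h1 h2 <;> omega
    · rintro ⟨⟨b, c, i, j⟩, hij, hj⟩
      dsimp only at hij hj
      simp only [StdIndex.wt]
      have e1 : b * (2 * h + 3 - 1) = 2 * ((h + 1) * b) := by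
        rw [show 2 * h + 3 - 1 = 2 * (h + 1) by omega]; ring
      have e2 : c * (2 * h + 3) = (2 * h + 3) * c := mul_comm _ _
      rw [e1, e2]
      split_ifs <;> omega

/-! ### Exponents -/

/-- The degree of a monomial in the variables `m_1, …, m_{d-2}`. -/
noncomputable def midDegree (d : ℕ) : (Fin (d + 1) →₀ ℕ) →+ ℕ :=
  Finsupp.weight fun i : Fin (d + 1) => if 1 ≤ (i : ℕ) ∧ (i : ℕ) ≤ d - 2 then 1 else 0

/-- The weight of a monomial, where `m_i` has weight `i`. -/
noncomputable def momentWeight (d : ℕ) : (Fin (d + 1) →₀ ℕ) →+ ℕ :=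
  Finsupp.weight fun i : Fin (d + 1) => (i : ℕ)

open Finsupp

theorem midDegree_single (d : ℕ) (i : Fin (d + 1)) (n : ℕ) :
    midDegree d (single i n) = if 1 ≤ (i : ℕ) ∧ (i : ℕ) ≤ d - 2 then n else 0 := by
  simp [midDegree, Finsupp.weight_single]

theorem momentWeight_single (d : ℕ) (i : Fin (d + 1)) (n : ℕ) :
    momentWeight d (single i n) = n * i := by
  simp [momentWeight, Finsupp.weight_single]

theorem exists_add_single {d : ℕ} {a : Fin (d + 1) →₀ ℕ} (h : midDegree d a ≠ 0) :
    ∃ (i : Fin (d + 1)) (b : Fin (d + 1) →₀ ℕ), 1 ≤ (i : ℕ) ∧ (i : ℕ) ≤ d - 2 ∧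
      a = b + single i 1 ∧ midDegree d a = midDegree d b + 1 := by
  rw [midDegree, Finsupp.weight_eq_sum] at h
  obtain ⟨i, -, hi⟩ := Finset.exists_ne_zero_of_sum_ne_zero h
  have hi2 : 1 ≤ (i : ℕ) ∧ (i : ℕ) ≤ d - 2 := by
    by_contra hc
    simp [hc] at hi
  have hai : a i ≠ 0 := fun hc => hi (by simp [hc])
  have ha : a = (a - single i 1) + single i 1 :=
    (tsub_add_cancel_of_le (by simpa [Nat.one_le_iff_ne_zero] using hai)).symm
  refine ⟨i, a - single i 1, hi2.1, hi2.2, ha, ?_⟩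
  conv_lhs => rw [ha]
  rw [map_add, midDegree_single, if_pos hi2]

theorem exists_add_three_singles {d : ℕ} {a : Fin (d + 1) →₀ ℕ} (h : 3 ≤ midDegree d a) :
    ∃ (i j k : Fin (d + 1)) (b : Fin (d + 1) →₀ ℕ), 1 ≤ (i : ℕ) ∧ i ≤ j ∧ j ≤ k ∧
      (k : ℕ) ≤ d - 2 ∧ a = b + (single i 1 + single j 1 + single k 1) := by
  obtain ⟨i, a', hi, hi', rfl, h1⟩ := exists_add_single (a := a) (by omega)
  obtain ⟨j, a', hj, hj', rfl, h2⟩ := exists_add_single (a := a') (by omega)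
  obtain ⟨k, b, hk, hk', rfl, h3⟩ := exists_add_single (a := a') (by omega)
  rcases le_total i j with hij | hij <;> rcases le_total j k with hjk | hjk <;>
    rcases le_total i k with hik | hik
  · exact ⟨i, j, k, b, hi, hij, hjk, hk', by abel⟩
  · exact ⟨i, j, k, b, hi, hij, hjk, hk', by abel⟩
  · exact ⟨i, k, j, b, hi, hik, hjk, hj', by abel⟩
  · exact ⟨k, i, j, b, hk, hik, hij, hj', by abel⟩
  · exact ⟨j, i, k, b, hj, hij, hik, hk', by abel⟩
  · exact ⟨j, k, i, b, hj, hjk, hik, hi', by abel⟩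
  · exact ⟨k, j, i, b, hk, hjk, hij, hi', by abel⟩
  · exact ⟨k, j, i, b, hk, hjk, hij, hi', by abel⟩

theorem eq_singles_of_midDegree_eq_zero {d : ℕ} (hd : 2 ≤ d) {a : Fin (d + 1) →₀ ℕ}
    (h : midDegree d a = 0) :
    a = single 0 (a 0) + single ⟨d - 1, by omega⟩ (a ⟨d - 1, by omega⟩) +
      single ⟨d, by omega⟩ (a ⟨d, by omega⟩) := by
  rw [midDegree, Finsupp.weight_eq_sum, Finset.sum_eq_zero_iff] at h
  have p1 : d - 1 < d + 1 := by omega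
  have p2 : d < d + 1 := by omega
  ext i
  have hi := h i (Finset.mem_univ i)
  have hlt := i.2
  by_cases hm : 1 ≤ (i : ℕ) ∧ (i : ℕ) ≤ d - 2
  · have hz : a i = 0 := by simpa [hm] using hi
    have h0 : (0 : Fin (d + 1)) ≠ i := fun e => by rw [← e] at hm; simp at hm
    have h1 : (⟨d - 1, by omega⟩ : Fin (d + 1)) ≠ i := fun e => by
      rw [← e] at hm; simp at hm; omega
    have h2 : (⟨d, by omega⟩ : Fin (d + 1)) ≠ i := fun e => by
      rw [← e] at hm; simp at hm; omega
    simp [hz, h0, h1, h2]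
  · obtain e | e | e : i = 0 ∨ i = ⟨d - 1, p1⟩ ∨ i = ⟨d, p2⟩ := by
      simp only [Fin.ext_iff, Fin.val_zero]; omega
    all_goals
      subst e
      simp only [Finsupp.add_apply, Finsupp.single_apply, Fin.ext_iff, Fin.val_zero]
      split_ifs <;> omega

/-- The exponent of `m_{d-1}^b m_d^c m_i m_j`. -/
noncomputable def StdIndex.exponent {d : ℕ} (q : StdIndex d) : Fin (d + 1) →₀ ℕ :=
  single ⟨d - 1, by omega⟩ q.1.1 + single ⟨d, by omega⟩ q.1.2.1 +
    single ⟨q.1.2.2.1, by have := q.2; omega⟩ 1 + single ⟨q.1.2.2.2, by have := q.2; omega⟩ 1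

theorem StdIndex.momentWeight_exponent {d : ℕ} (q : StdIndex d) :
    momentWeight d q.exponent = q.wt := by
  simp [StdIndex.exponent, StdIndex.wt, momentWeight_single]

/-- The factor m_0² supplies the missing factors m_i, m_j with index 0 without any subtraction from
the exponent of m_0. In a fixed degree r is determined by the index. -/
theorem exists_stdIndex {d : ℕ} (hd : 2 ≤ d) {a : Fin (d + 1) →₀ ℕ} (h : midDegree d a ≤ 2) :
    ∃ (q : StdIndex d) (r : ℕ), a + single 0 2 = single 0 r + q.exponent := by
  obtain h0 | h0 | h0 : midDegree d a = 0 ∨ midDegree d a = 1 ∨ midDegree d a = 2 := by omega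
  · have e := eq_singles_of_midDegree_eq_zero hd h0
    refine ⟨⟨(a ⟨d - 1, by omega⟩, a ⟨d, by omega⟩, 0, 0), by simp; omega⟩, a 0, ?_⟩
    conv_lhs => rw [e]
    simp only [StdIndex.exponent, Fin.mk_zero', show (2 : ℕ) = 1 + 1 from rfl, single_add]
    abel
  · obtain ⟨i, b, hi, hi', rfl, h1⟩ := exists_add_single (a := a) (by omega)
    have e := eq_singles_of_midDegree_eq_zero hd (a := b) (by omega)
    refine ⟨⟨(b ⟨d - 1, by omega⟩, b ⟨d, by omega⟩, 0, i), by simp; omega⟩, b 0 + 1, ?_⟩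
    conv_lhs => rw [e]
    simp only [StdIndex.exponent, Fin.mk_zero', show (2 : ℕ) = 1 + 1 from rfl, single_add]
    abel
  · obtain ⟨i, b, hi, hi', rfl, h1⟩ := exists_add_single (a := a) (by omega)
    obtain ⟨j, b, hj, hj', rfl, h2⟩ := exists_add_single (a := b) (by omega)
    have e := eq_singles_of_midDegree_eq_zero hd (a := b) (by omega)
    rcases le_total i j with hij | hij
    · refine ⟨⟨(b ⟨d - 1, by omega⟩, b ⟨d, by omega⟩, i, j), by simp; omega⟩, b 0 + 2, ?_⟩
      conv_lhs => rw [e]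
      simp only [StdIndex.exponent, single_add]
      abel
    · refine ⟨⟨(b ⟨d - 1, by omega⟩, b ⟨d, by omega⟩, j, i), by simp; omega⟩, b 0 + 2, ?_⟩
      conv_lhs => rw [e]
      simp only [StdIndex.exponent, single_add]
      abel

/-! ### Monomial orders -/

/-- Ties are decided against the product that contains the smallest variable. Among the four this is
m_l for one order and m_i for the other, and both sit in the outer product. -/
theorem degRevLex_swap {d : ℕ} {e : Fin (d + 1) ≃ Fin (d + 1)}
    (he : e = Equiv.refl (Fin (d + 1)) ∨ e = Fin.revPerm) {i j k l : Fin (d + 1)}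
    (hij : i < j) (hjk : j ≤ k) (hkl : k < l) :
    (degRevLex e).toSyn (single i 1 + single l 1) <
      (degRevLex e).toSyn (single j 1 + single k 1) := by
  refine (DegRevLex.lt_iff e _ _).2 (Or.inr ⟨by simp, ?_⟩)
  rcases he with rfl | rfl
  · refine ⟨l, fun m hm => ?_, ?_⟩
    · simp only [Equiv.refl_apply] at hm
      simp only [Finsupp.add_apply, Finsupp.single_apply]
      rw [if_neg, if_neg, if_neg, if_neg] <;> intro h <;> omega
    · simp only [Finsupp.add_apply, Finsupp.single_apply]
      rw [if_neg, if_neg] <;> first | simp | (intro h; omega)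
  · refine ⟨i, fun m hm => ?_, ?_⟩
    · simp only [Fin.revPerm_apply, Fin.rev_lt_rev] at hm
      simp only [Finsupp.add_apply, Finsupp.single_apply]
      rw [if_neg, if_neg, if_neg, if_neg] <;> intro h <;> omega
    · simp only [Finsupp.add_apply, Finsupp.single_apply]
      rw [if_neg, if_neg] <;> first | simp | (intro h; omega)

/-! ### The minors -/

/-- The exponent of `m_x m_y m_z`. -/
noncomputable def cubicExponent (d x y z : ℕ) : Fin (d + 1) →₀ ℕ :=
  single (Fin.ofNat (d + 1) x) 1 + single (Fin.ofNat (d + 1) y) 1 + single (Fin.ofNat (d + 1) z) 1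

theorem degree_cubicExponent (d x y z : ℕ) : (cubicExponent d x y z).degree = 3 := by
  simp [cubicExponent]

/-- The bounds are needed because `Fin.ofNat` reads indices modulo d + 1. -/
theorem momentWeight_cubicExponent {d x y z : ℕ} (hx : x ≤ d) (hy : y ≤ d) (hz : z ≤ d) :
    momentWeight d (cubicExponent d x y z) = x + y + z := by
  simp [cubicExponent, momentWeight_single, Nat.mod_eq_of_lt (Nat.lt_succ_of_le hx),
    Nat.mod_eq_of_lt (Nat.lt_succ_of_le hy), Nat.mod_eq_of_lt (Nat.lt_succ_of_le hz)]

theorem cubicExponent_val {d : ℕ} (i j k : Fin (d + 1)) :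
    cubicExponent d i j k = single i 1 + single j 1 + single k 1 := by
  simp [cubicExponent]

/-- A monomial order prefers products of variables with indices close to each other. -/
def IsBalanced {d : ℕ} (mo : MonomialOrder (Fin (d + 1))) : Prop :=
  ∀ ⦃i j k l : Fin (d + 1)⦄, i < j → j ≤ k → k < l →
    mo.toSyn (single i 1 + single l 1) < mo.toSyn (single j 1 + single k 1)

theorem isBalanced_degRevLex {d : ℕ} {e : Fin (d + 1) ≃ Fin (d + 1)}
    (he : e = Equiv.refl (Fin (d + 1)) ∨ e = Fin.revPerm) : IsBalanced (degRevLex e) :=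
  fun _ _ _ _ hij hjk hkl => degRevLex_swap he hij hjk hkl

/-! ### Leading terms of the minors -/

section Order

variable {d : ℕ} {mo : MonomialOrder (Fin (d + 1))}

theorem IsBalanced.cubicExponent_lt (h : IsBalanced mo) {x y z w : ℕ} (v : ℕ) (hxy : x < y)
    (hyz : y ≤ z) (hzw : z < w) (hw : w ≤ d) :
    mo.toSyn (cubicExponent d x v w) < mo.toSyn (cubicExponent d y v z) := by
  have key := @h (Fin.ofNat _ x) (Fin.ofNat _ y) (Fin.ofNat _ z) (Fin.ofNat _ w)
    (by simp [Fin.lt_def]; rw [Nat.mod_eq_of_lt, Nat.mod_eq_of_lt] <;> omega)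
    (by simp [Fin.le_def]; rw [Nat.mod_eq_of_lt, Nat.mod_eq_of_lt] <;> omega)
    (by simp [Fin.lt_def]; rw [Nat.mod_eq_of_lt, Nat.mod_eq_of_lt] <;> omega)
  have := add_lt_add_left key (mo.toSyn (single (Fin.ofNat _ v) 1))
  simp only [← map_add] at this
  convert this using 2 <;> rw [cubicExponent] <;> abel

theorem cubicExponent_comm_left (d x y z : ℕ) :
    cubicExponent d x y z = cubicExponent d y x z := by
  rw [cubicExponent, cubicExponent]; abel

theorem cubicExponent_comm_right (d x y z : ℕ) :
    cubicExponent d x y z = cubicExponent d x z y := by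
  rw [cubicExponent, cubicExponent]; abel

/-- The exponents smaller than `a`, with the same degree and weight. -/
def lowerExponents (mo : MonomialOrder (Fin (d + 1))) (a : Fin (d + 1) →₀ ℕ) :
    Set (Fin (d + 1) →₀ ℕ) :=
  {b | mo.toSyn b < mo.toSyn a ∧ b.degree = a.degree ∧ momentWeight d b = momentWeight d a}

variable {K : Type*} [Field K]

theorem X_mul_X_mul_X_eq (d x y z : ℕ) (n : ℕ) :
    (n : MvPolynomial (Fin (d + 1)) K) * MvPolynomial.X (Fin.ofNat _ x) *
      MvPolynomial.X (Fin.ofNat _ y) * MvPolynomial.X (Fin.ofNat _ z) =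
      MvPolynomial.monomial (cubicExponent d x y z) (n : K) := by
  rw [cubicExponent, ← mul_one (n : K), ← MvPolynomial.C_mul_monomial, ← mul_one (1 : K),
    ← MvPolynomial.monomial_mul, ← mul_one (1 : K), ← MvPolynomial.monomial_mul]
  simp [MvPolynomial.X, mul_assoc]

theorem momentMinor_eq (c : Fin 3 ↪o Fin d) :
    ((momentMatrix K d).submatrix id c).det =
      MvPolynomial.monomial (cubicExponent d (c 0 - 1) (c 1) (c 2 + 1)) ((c 0 : ℕ) : K) -
      MvPolynomial.monomial (cubicExponent d (c 0 - 1) (c 1 + 1) (c 2)) ((c 0 : ℕ) : K) -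
      MvPolynomial.monomial (cubicExponent d (c 0) (c 1 - 1) (c 2 + 1)) ((c 1 : ℕ) : K) +
      MvPolynomial.monomial (cubicExponent d (c 0 + 1) (c 1 - 1) (c 2)) ((c 1 : ℕ) : K) +
      MvPolynomial.monomial (cubicExponent d (c 0) (c 1 + 1) (c 2 - 1)) ((c 2 : ℕ) : K) -
      MvPolynomial.monomial (cubicExponent d (c 0 + 1) (c 1) (c 2 - 1)) ((c 2 : ℕ) : K) := by
  have h0 (j : Fin d) : (⟨(j : ℕ) - 1, by omega⟩ : Fin (d + 1)) = Fin.ofNat _ (j - 1 : ℕ) :=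
    Fin.ext (by simp only [Fin.val_ofNat]; rw [Nat.mod_eq_of_lt]; omega)
  have h1 (j : Fin d) : j.castSucc = Fin.ofNat (d + 1) (j : ℕ) :=
    Fin.ext (by simp only [Fin.val_ofNat, Fin.val_castSucc]; rw [Nat.mod_eq_of_lt]; omega)
  have h2 (j : Fin d) : j.succ = Fin.ofNat (d + 1) (j + 1 : ℕ) :=
    Fin.ext (by simp only [Fin.val_ofNat, Fin.val_succ]; rw [Nat.mod_eq_of_lt]; omega)
  simp only [← X_mul_X_mul_X_eq, Matrix.det_fin_three, momentMatrix, Matrix.submatrix_apply,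
    Matrix.of_apply, id, Matrix.cons_val_zero, Matrix.cons_val_one, Matrix.cons_val, h0, h1, h2]
  ring

/-- Every other term of the determinant arises from this one by spreading pairs of indices apart,
which lowers the monomial and preserves degree and weight. -/
theorem IsBalanced.exists_momentMinor_eq (h : IsBalanced mo) (c : Fin 3 ↪o Fin d) :
    ∃ g ∈ MvPolynomial.restrictSupport K
        (lowerExponents mo (cubicExponent d (c 0 + 1) (c 1) (c 2 - 1))),
      ((momentMatrix K d).submatrix id c).det = g -
        MvPolynomial.monomial (cubicExponent d (c 0 + 1) (c 1) (c 2 - 1)) ((c 2 : ℕ) : K) := by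
  refine ⟨_, ?_, momentMinor_eq c⟩
  have h01 : (c 0 : ℕ) < c 1 := c.strictMono (by decide)
  have h12 : (c 1 : ℕ) < c 2 := c.strictMono (by decide)
  have h2 : (c 2 : ℕ) < d := (c 2).2
  generalize (c 0 : ℕ) = x at *
  generalize (c 1 : ℕ) = y at *
  generalize (c 2 : ℕ) = z at *
  have t5 : mo.toSyn (cubicExponent d x (y + 1) (z - 1)) <
      mo.toSyn (cubicExponent d (x + 1) y (z - 1)) := by
    rw [cubicExponent_comm_right, cubicExponent_comm_right d (x + 1)]
    exact h.cubicExponent_lt _ (by omega) (by omega) (by omega) (by omega)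
  have t4 : mo.toSyn (cubicExponent d (x + 1) (y - 1) z) <
      mo.toSyn (cubicExponent d (x + 1) y (z - 1)) := by
    rw [cubicExponent_comm_left, cubicExponent_comm_left d (x + 1)]
    exact h.cubicExponent_lt _ (by omega) (by omega) (by omega) (by omega)
  have t3 : mo.toSyn (cubicExponent d x (y - 1) (z + 1)) <
      mo.toSyn (cubicExponent d (x + 1) y (z - 1)) :=
    (h.cubicExponent_lt _ (by omega) (by omega) (by omega) (by omega)).trans t4
  have t2 (hx : x ≠ 0) : mo.toSyn (cubicExponent d (x - 1) (y + 1) z) <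
      mo.toSyn (cubicExponent d (x + 1) y (z - 1)) :=
    (h.cubicExponent_lt _ (by omega) (by omega) (by omega) (by omega)).trans t5
  have t1 (hx : x ≠ 0) : mo.toSyn (cubicExponent d (x - 1) y (z + 1)) <
      mo.toSyn (cubicExponent d (x + 1) y (z - 1)) :=
    h.cubicExponent_lt _ (by omega) (by omega) (by omega) (by omega)
  have mem {u v w : ℕ} (hu : u ≤ d) (hv : v ≤ d) (hw : w ≤ d) (hs : u + v + w = x + y + z)
      (hlt : mo.toSyn (cubicExponent d u v w) < mo.toSyn (cubicExponent d (x + 1) y (z - 1))) :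
      cubicExponent d u v w ∈ lowerExponents mo (cubicExponent d (x + 1) y (z - 1)) := by
    refine ⟨hlt, by rw [degree_cubicExponent, degree_cubicExponent], ?_⟩
    rw [momentWeight_cubicExponent hu hv hw,
      momentWeight_cubicExponent (by omega) (by omega) (by omega)]
    omega
  refine add_mem (add_mem (sub_mem (sub_mem ?_ ?_) ?_) ?_) ?_ <;>
    rw [MvPolynomial.monomial_mem_restrictSupport]
  -- For x = 0 the truncated index x - 1 spoils the weight, but the coefficient x vanishes.
  · by_cases hx : x = 0
    · exact Or.inr (by simp [hx])
    · exact Or.inl (mem (by omega) (by omega) (by omega) (by omega) (t1 hx))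
  · by_cases hx : x = 0
    · exact Or.inr (by simp [hx])
    · exact Or.inl (mem (by omega) (by omega) (by omega) (by omega) (t2 hx))
  · exact Or.inl (mem (by omega) (by omega) (by omega) (by omega) t3)
  · exact Or.inl (mem (by omega) (by omega) (by omega) (by omega) t4)
  · exact Or.inl (mem (by omega) (by omega) (by omega) (by omega) t5)

theorem IsBalanced.leadingTerm_momentMinor [CharZero K] (h : IsBalanced mo)
    (c : Fin 3 ↪o Fin d) :
    mo.leadingTerm ((momentMatrix K d).submatrix id c).det =
      MvPolynomial.monomial (cubicExponent d (c 0 + 1) (c 1) (c 2 - 1)) (-((c 2 : ℕ) : K)) := by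
  classical
  obtain ⟨g, hg, hdet⟩ := h.exists_momentMinor_eq (K := K) c
  have h2 : -((c 2 : ℕ) : K) ≠ 0 := by
    have : (c 0 : ℕ) < c 2 := c.strictMono (by decide)
    rw [neg_ne_zero, Nat.cast_ne_zero]
    omega
  set L := cubicExponent d (c 0 + 1) (c 1) (c 2 - 1) with hL
  have hL0 : mo.toSyn 0 < mo.toSyn L := by
    refine lt_of_le_of_ne (mo.toSyn_monotone zero_le) fun h0 => ?_
    have := degree_cubicExponent d (c 0 + 1) (c 1) (c 2 - 1)
    rw [← hL, ← mo.toSyn.injective h0] at this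
    simp at this
  have hdeg : mo.degree (MvPolynomial.monomial L (-((c 2 : ℕ) : K))) = L := by
    rw [mo.degree_monomial, if_neg h2]
  have hlt : mo.toSyn (mo.degree g) <
      mo.toSyn (mo.degree (MvPolynomial.monomial L (-((c 2 : ℕ) : K)))) := by
    rw [hdeg, mo.degree_lt_iff hL0]
    exact fun b hb => (hg hb).1
  rw [hdet, sub_eq_neg_add, ← map_neg, MonomialOrder.leadingTerm, mo.degree_add_of_lt hlt,
    mo.leadingCoeff_add_of_lt hlt, hdeg, mo.leadingCoeff_monomial]

end Order

/-- The recurrence says that the last row is x times the middle row plus y times the top row. At n =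
0 the truncated n - 1 is harmless because of the factor n. -/
theorem map_momentMinor_eq_zero {K R : Type*} [Field K] [CommRing R] [Algebra K R] {d : ℕ}
    (φ : MvPolynomial (Fin (d + 1)) K →ₐ[K] R) (N : ℕ → R) (x y : R)
    (hφ : ∀ i, φ (MvPolynomial.X i) = N i)
    (hN : ∀ n : ℕ, N (n + 1) = x * N n + n * y * N (n - 1)) (c : Fin 3 ↪o Fin d) :
    φ ((momentMatrix K d).submatrix id c).det = 0 := by
  simp only [Matrix.det_fin_three, momentMatrix, Matrix.submatrix_apply,
    Matrix.of_apply, id, Matrix.cons_val_zero, Matrix.cons_val_one, Matrix.cons_val, map_add,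
    map_sub, map_mul, hφ, map_natCast, Fin.val_castSucc, Fin.val_succ, hN]
  ring

theorem momentHom_momentMinor {K : Type*} [Field K] {d : ℕ} (c : Fin 3 ↪o Fin d) :
    momentHom K d ((momentMatrix K d).submatrix id c).det = 0 :=
  map_momentMinor_eq_zero _ (momentPoly K) _ _ (fun i => by simp [momentHom])
    (momentPoly_succ K) c

theorem coneHom_momentMinor {K : Type*} [Field K] {d : ℕ} (c : Fin 3 ↪o Fin d) :
    coneHom K d ((momentMatrix K d).submatrix id c).det = 0 := by
  refine map_momentMinor_eq_zero _ (fun n => Polynomial.C (momentPoly K n) * Polynomial.X)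
    (Polynomial.C (MvPolynomial.X 0)) (Polynomial.C (MvPolynomial.X 1 - MvPolynomial.X 0 ^ 2))
    (fun i => by simp [coneHom]) (fun n => ?_) c
  rw [momentPoly_succ, map_add, map_mul, map_mul, map_mul, Polynomial.C_eq_natCast]
  ring

theorem exists_columns {d : ℕ} {i j k : Fin (d + 1)} (hd : 2 ≤ d) (hi : 1 ≤ (i : ℕ)) (hij : i ≤ j)
    (hjk : j ≤ k) (hk : (k : ℕ) ≤ d - 2) :
    ∃ c : Fin 3 ↪o Fin d, cubicExponent d (c 0 + 1) (c 1) (c 2 - 1) =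
      single i 1 + single j 1 + single k 1 := by
  -- These columns invert (a, b, c) ↦ (a + 1, b, c - 1); the bounds 1 ≤ i and k ≤ d - 2 make i - 1
  -- and k + 1 admissible and the sequence strictly increasing.
  refine ⟨OrderEmbedding.ofStrictMono
    ![⟨i - 1, by omega⟩, ⟨j, by omega⟩, ⟨k + 1, by omega⟩] ?_, ?_⟩
  · rw [Fin.strictMono_iff_lt_succ]
    intro n
    fin_cases n
    · simp [Fin.lt_def]; omega
    · simp [Fin.lt_def]; omega
  · simp [Nat.sub_add_cancel hi, cubicExponent_val]

/-! ### Normal forms -/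

section NormalForm

variable {d : ℕ} {mo : MonomialOrder (Fin (d + 1))} {K : Type*} [Field K]

/-- Exponents of the standard monomials that may occur in the normal form of `a`. -/
def normalExponents (mo : MonomialOrder (Fin (d + 1))) (a : Fin (d + 1) →₀ ℕ) :
    Set (Fin (d + 1) →₀ ℕ) :=
  {b | midDegree d b ≤ 2 ∧ mo.toSyn b ≤ mo.toSyn a ∧ b.degree = a.degree ∧
    momentWeight d b = momentWeight d a}

/-- Division by the minors, carried out on images: a nonstandard monomial is a multiple of the
leading monomial of some minor, and that minor maps to zero, so the image is a combination of images
of smaller monomials of the same degree and weight. -/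
theorem IsBalanced.momentHom_monomial_mem_span [CharZero K] (h : IsBalanced mo) (hd : 2 ≤ d)
    (a : Fin (d + 1) →₀ ℕ) :
    momentHom K d (MvPolynomial.monomial a 1) ∈ Submodule.span K
      ((fun b => momentHom K d (MvPolynomial.monomial b 1)) '' normalExponents mo a) := by
  induction hs : mo.toSyn a using WellFoundedLT.induction generalizing a with
  | ind s ih =>
    subst hs
    by_cases hstd : midDegree d a ≤ 2
    · exact Submodule.subset_span ⟨a, ⟨hstd, le_rfl, rfl, rfl⟩, rfl⟩
    obtain ⟨i, j, k, b, hi, hij, hjk, hk, ha⟩ := exists_add_three_singles (a := a) (by omega)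
    obtain ⟨c, hc⟩ := exists_columns hd hi hij hjk hk
    obtain ⟨g, hg, hdet⟩ := h.exists_momentMinor_eq (K := K) c
    have h0 := congrArg (momentHom K d) hdet
    rw [momentHom_momentMinor, hc] at h0
    rw [hc] at hg
    rw [map_sub, eq_comm, sub_eq_zero] at h0
    have h2 : ((c 2 : ℕ) : K) ≠ 0 := by
      have : (c 0 : ℕ) < c 2 := c.strictMono (by decide)
      rw [Nat.cast_ne_zero]
      omega
    have hmem : momentHom K d (MvPolynomial.monomial b 1 * g) ∈ Submodule.span K
        ((fun b => momentHom K d (MvPolynomial.monomial b 1)) '' normalExponents mo a) := by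
      rw [g.as_sum, Finset.mul_sum, map_sum]
      refine Submodule.sum_mem _ fun e he => ?_
      obtain ⟨hlt, hdeg, hwt⟩ := hg he
      have hlt' : mo.toSyn (b + e) < mo.toSyn a := by
        rw [ha, map_add, map_add]
        exact add_lt_add_right hlt _
      rw [MvPolynomial.monomial_mul, one_mul, ← mul_one (MvPolynomial.coeff e g),
        ← smul_eq_mul, ← MvPolynomial.smul_monomial, map_smul]
      refine Submodule.smul_mem _ _ (Submodule.span_mono (Set.image_mono ?_)
        (ih _ hlt' (b + e) rfl))
      rintro u ⟨hu1, hu2, hu3, hu4⟩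
      refine ⟨hu1, hu2.trans hlt'.le, ?_, ?_⟩
      · rw [hu3, ha, map_add, map_add, hdeg]
      · rw [hu4, ha, map_add, map_add, hwt]
    have heq : momentHom K d (MvPolynomial.monomial b 1 * g) =
        ((c 2 : ℕ) : K) • momentHom K d (MvPolynomial.monomial a 1) := by
      rw [map_mul, h0, ← map_mul, MvPolynomial.monomial_mul, ← ha, one_mul, ← map_smul,
        MvPolynomial.smul_monomial, smul_eq_mul, mul_one]
    rw [heq] at hmem
    exact (Submodule.smul_mem_iff _ h2).1 hmem

theorem momentHom_monomial_of_add_eq {a : Fin (d + 1) →₀ ℕ} {q : StdIndex d} {r : ℕ}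
    (h : a + single 0 2 = single 0 r + q.exponent) :
    momentHom K d (MvPolynomial.monomial a 1) =
      momentHom K d (MvPolynomial.monomial q.exponent 1) := by
  have h0 (n : ℕ) : momentHom K d (MvPolynomial.monomial (single 0 n) 1) = 1 := by
    rw [momentHom, MvPolynomial.aeval_monomial]
    simp [momentPoly]
  have := congrArg (fun u => momentHom K d (MvPolynomial.monomial u 1)) h
  have hmul (u v : Fin (d + 1) →₀ ℕ) : (MvPolynomial.monomial (u + v) 1 :
      MvPolynomial (Fin (d + 1)) K) = MvPolynomial.monomial u 1 * MvPolynomial.monomial v 1 := by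
    rw [MvPolynomial.monomial_mul, one_mul]
  simpa only [hmul, map_mul, h0, mul_one, one_mul] using this

theorem wt_of_add_eq {a : Fin (d + 1) →₀ ℕ} {q : StdIndex d} {r : ℕ}
    (h : a + single 0 2 = single 0 r + q.exponent) : q.wt = momentWeight d a := by
  have := congrArg (momentWeight d) h
  simp only [map_add, momentWeight_single, q.momentWeight_exponent, Fin.val_zero] at this
  omega

theorem monomial_mem_span_std [CharZero K] (hd : 3 ≤ d) (p q : ℕ) :
    (MvPolynomial.monomial (single 0 p + single 1 q) 1 : MvPolynomial (Fin 2) K) ∈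
      Submodule.span K ((fun u : StdIndex d => momentHom K d (MvPolynomial.monomial u.exponent 1)) ''
        {u | u.wt = p + 2 * q}) := by
  -- Any balanced order would do, since the conclusion mentions none.
  have hbal := isBalanced_degRevLex (d := d) (Or.inl rfl)
  have h := hbal.momentHom_monomial_mem_span (K := K) (by omega)
    (single ⟨1, by omega⟩ p + single ⟨2, by omega⟩ q)
  have e : momentHom K d (MvPolynomial.monomial (single ⟨1, by omega⟩ p + single ⟨2, by omega⟩ q) 1)
      = MvPolynomial.monomial (single 0 p + single 1 q) 1 := by
    rw [← mul_one (1 : K), ← MvPolynomial.monomial_mul, ← MvPolynomial.monomial_mul, map_mul]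
    have h1 : momentPoly K 1 = MvPolynomial.X 0 := rfl
    simp only [momentHom, MvPolynomial.aeval_monomial]
    simp [momentPoly_two, h1, MvPolynomial.X_pow_eq_monomial]
  rw [e] at h
  refine Submodule.span_mono ?_ h
  rintro _ ⟨b, ⟨hb1, -, -, hb4⟩, rfl⟩
  obtain ⟨u, r, hu⟩ := exists_stdIndex (by omega) hb1
  refine ⟨u, ?_, (momentHom_monomial_of_add_eq hu).symm⟩
  rw [Set.mem_ofPred_eq, wt_of_add_eq hu, hb4]
  simp [momentWeight_single, mul_comm]

/-- Truncation to weight at most W makes everything finite. The images of the standard monomials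
span a space containing all parameter monomials of weight at most W, and by the injection there are
at most as many standard monomials as those, so they are independent. -/
theorem linearIndependent_std [CharZero K] (hd : 3 ≤ d) :
    LinearIndependent K fun u : StdIndex d =>
      momentHom K d (MvPolynomial.monomial u.exponent 1) := by
  rw [linearIndependent_iff_finset_linearIndependent]
  intro s
  set W := s.sup StdIndex.wt
  obtain ⟨F, hF, hFw⟩ := exists_injective_weight d (by omega)
  let D : Set (ℕ × ℕ) := {x | x.1 + 2 * x.2 ≤ W}
  have hD : D.Finite := by
    refine ((Set.finite_Iic W).prod (Set.finite_Iic W)).subset ?_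
    rintro ⟨p, q⟩ h
    simp only [D, Set.mem_ofPred_eq] at h
    simp only [Set.mem_prod, Set.mem_Iic]
    omega
  let Q : Set (StdIndex d) := {u | u.wt ≤ W}
  have : Fintype D := hD.fintype
  let G : Q → D := fun u => ⟨F u.1, by
    simp only [D, Set.mem_ofPred_eq, hFw]; exact u.2⟩
  have hG : Function.Injective G := fun u v huv => Subtype.ext (hF (congrArg Subtype.val huv))
  have : Fintype Q := Fintype.ofInjective G hG
  have hQ : LinearIndependent K fun u : Q =>
      momentHom K d (MvPolynomial.monomial u.1.exponent 1) := by
    rw [linearIndependent_iff_card_le_finrank_span]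
    have hmon : LinearIndependent K fun x : D =>
        (MvPolynomial.monomial (single 0 x.1.1 + single 1 x.1.2) 1 : MvPolynomial (Fin 2) K) := by
      refine (MvPolynomial.basisMonomials (Fin 2) K).linearIndependent.comp
        (fun x : D => single (0 : Fin 2) x.1.1 + single 1 x.1.2) ?_
      intro x y hxy
      have h0 := DFunLike.congr_fun hxy 0
      have h1 := DFunLike.congr_fun hxy 1
      simp at h0 h1
      exact Subtype.ext (Prod.ext h0 h1)
    refine (Fintype.card_le_of_injective G hG).trans ?_
    rw [← finrank_span_eq_card hmon]
    have : Module.Finite K (Submodule.span K (Set.range fun u : Q =>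
      momentHom K d (MvPolynomial.monomial u.1.exponent 1))) :=
      FiniteDimensional.span_of_finite K (Set.finite_range _)
    refine Submodule.finrank_mono (Submodule.span_le.2 ?_)
    rintro _ ⟨x, rfl⟩
    refine Submodule.span_mono ?_ (monomial_mem_span_std hd x.1.1 x.1.2)
    rintro _ ⟨u, hu, rfl⟩
    exact ⟨⟨u, (le_of_eq hu).trans x.2⟩, rfl⟩
  exact hQ.comp (fun u : s => (⟨u.1, Finset.le_sup (f := StdIndex.wt) u.2⟩ : Q))
    fun u v huv => Subtype.ext (congrArg (fun z => z.1) huv)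

/-- Leading exponents of polynomials in the ideal are not standard. -/
theorem IsBalanced.three_le_midDegree [CharZero K] (h : IsBalanced mo) (hd : 3 ≤ d)
    {f : MvPolynomial (Fin (d + 1)) K} (hf : coneHom K d f = 0) (hf0 : f ≠ 0) :
    3 ≤ midDegree d (mo.degree f) := by
  -- If the leading exponent a were standard, the relation in degree `a.degree` would express its
  -- image through images of standard monomials below a, against linear independence.
  by_contra hlt
  set a := mo.degree f with ha
  have hcoeff : MvPolynomial.coeff a f ≠ 0 := mo.coeff_degree_ne_zero_iff.2 hf0
  have hstd : midDegree d a ≤ 2 := by omega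
  have hzero : momentHom K d (MvPolynomial.homogeneousComponent a.degree f) = 0 := by
    rw [← coeff_coneHom, hf, Polynomial.coeff_zero]
  have : Nonempty (StdIndex d) := ⟨⟨(0, 0, 0, 0), le_rfl, by dsimp only; omega⟩⟩
  choose! Q r hQ using fun (b : Fin (d + 1) →₀ ℕ) (hb : midDegree d b ≤ 2) =>
    exists_stdIndex (a := b) (d := d) (by omega) hb
  -- Setting m_0 = 1 identifies no two standard monomials of equal degree; this is why the reduction
  -- had to keep track of the degree.
  have hinj {b : Fin (d + 1) →₀ ℕ} (hb : midDegree d b ≤ 2) (hdeg : b.degree = a.degree)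
      (hba : Q b = Q a) : b = a := by
    have h1 := hQ b hb
    have h2 := hQ a hstd
    rw [hba] at h1
    have d1 := congrArg Finsupp.degree h1
    have d2 := congrArg Finsupp.degree h2
    simp only [map_add, Finsupp.degree_single] at d1 d2
    have hr : r b = r a := by omega
    rw [hr, ← h2] at h1
    exact add_right_cancel h1
  refine (linearIndependent_std (K := K) hd).notMem_span_image (s := {u | u ≠ Q a}) (x := Q a)
    (by simp) ?_
  rw [← momentHom_monomial_of_add_eq (hQ a hstd)]
  have hmem (b : Fin (d + 1) →₀ ℕ) (hb : mo.toSyn b < mo.toSyn a) (hdeg : b.degree = a.degree) :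
      momentHom K d (MvPolynomial.monomial b 1) ∈ Submodule.span K
        ((fun u : StdIndex d => momentHom K d (MvPolynomial.monomial u.exponent 1)) ''
          {u | u ≠ Q a}) := by
    refine Submodule.span_mono ?_ (h.momentHom_monomial_mem_span (K := K) (by omega) b)
    rintro _ ⟨u, ⟨hu1, hu2, hu3, -⟩, rfl⟩
    refine ⟨Q u, fun hc => ?_, (momentHom_monomial_of_add_eq (hQ u hu1)).symm⟩
    have := hinj hu1 (hu3.trans hdeg) hc
    subst this
    exact absurd hb hu2.not_gt
  classical
  rw [MvPolynomial.homogeneousComponent_apply, map_sum] at hzero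
  have hmema : a ∈ f.support.filter fun b => b.degree = a.degree := by
    simp [hcoeff]
  rw [← Finset.add_sum_erase _ _ hmema] at hzero
  have hsmul (b : Fin (d + 1) →₀ ℕ) (t : K) : momentHom K d (MvPolynomial.monomial b t) =
      t • momentHom K d (MvPolynomial.monomial b 1) := by
    rw [← map_smul, MvPolynomial.smul_monomial, smul_eq_mul, mul_one]
  rw [hsmul] at hzero
  rw [← Submodule.smul_mem_iff _ hcoeff, eq_neg_of_add_eq_zero_left hzero]
  refine Submodule.neg_mem _ (Submodule.sum_mem _ fun b hb => ?_)
  rw [hsmul]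
  simp only [Finset.mem_erase, Finset.mem_filter] at hb
  refine Submodule.smul_mem _ _ (hmem b (lt_of_le_of_ne (mo.le_degree hb.2.1) ?_) hb.2.2)
  exact fun hc => hb.1 (mo.toSyn.injective hc)

end NormalForm

/-! ### The initial ideal -/

section Main

variable {d : ℕ} {mo : MonomialOrder (Fin (d + 1))} (K : Type*) [Field K]

/-- The ideal generated by the variables `m_1, …, m_{d-2}`. -/
noncomputable def midIdeal (d : ℕ) : Ideal (MvPolynomial (Fin (d + 1)) K) :=
  Ideal.span {f | ∃ i : Fin (d + 1), 1 ≤ (i : ℕ) ∧ (i : ℕ) ≤ d - 2 ∧ f = MvPolynomial.X i}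

theorem momentMinors_subset [CharZero K] :
    momentMinors K d ⊆ (projIdeal (gaussianMomentVariety K d) : Set _) := by
  rintro _ ⟨c, rfl⟩
  exact (mem_projIdeal_gaussianMomentVariety _ _).2 (coneHom_momentMinor c)

theorem monomial_mem_midIdeal_pow {a : Fin (d + 1) →₀ ℕ} (h : 3 ≤ midDegree d a) (t : K) :
    MvPolynomial.monomial a t ∈ midIdeal K d ^ 3 := by
  obtain ⟨i, j, k, b, hi, hij, hjk, hk, rfl⟩ := exists_add_three_singles h
  have e : (MvPolynomial.monomial (b + (single i 1 + single j 1 + single k 1)) t :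
      MvPolynomial (Fin (d + 1)) K) = MvPolynomial.monomial b t *
        (MvPolynomial.X i * MvPolynomial.X j * MvPolynomial.X k) := by
    simp [MvPolynomial.X, MvPolynomial.monomial_mul]
  rw [e]
  refine Ideal.mul_mem_left _ _ ?_
  rw [pow_succ, pow_two]
  exact Ideal.mul_mem_mul (Ideal.mul_mem_mul
    (Ideal.subset_span ⟨i, hi, by omega, rfl⟩) (Ideal.subset_span ⟨j, by omega, by omega, rfl⟩))
    (Ideal.subset_span ⟨k, by omega, hk, rfl⟩)

theorem IsBalanced.initialIdeal_le [CharZero K] (h : IsBalanced mo) (hd : 3 ≤ d) :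
    initialIdeal mo (projIdeal (gaussianMomentVariety K d)) ≤ midIdeal K d ^ 3 := by
  refine Ideal.span_le.2 ?_
  rintro _ ⟨f, hf, rfl⟩
  by_cases hf0 : f = 0
  · simp [hf0]
  · exact monomial_mem_midIdeal_pow K
      (h.three_le_midDegree hd ((mem_projIdeal_gaussianMomentVariety _ _).1 hf) hf0) _

theorem IsBalanced.midIdeal_pow_le [CharZero K] (h : IsBalanced mo) (hd : 3 ≤ d) :
    midIdeal K d ^ 3 ≤ Ideal.span (mo.leadingTerm '' momentMinors K d) := by
  have hsub : midIdeal K d ^ 3 ≤ Ideal.span ((fun a => MvPolynomial.monomial a (1 : K)) ''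
      {a | 3 ≤ midDegree d a}) := by
    rw [midIdeal, pow_succ, pow_two, Ideal.span_mul_span', Ideal.span_mul_span', Ideal.span_le]
    rintro _ ⟨_, ⟨_, ⟨i, hi, hi', rfl⟩, _, ⟨j, hj, hj', rfl⟩, rfl⟩, _, ⟨k, hk, hk', rfl⟩, rfl⟩
    refine Ideal.subset_span ⟨single i 1 + single j 1 + single k 1, ?_, ?_⟩
    · simp [midDegree_single, *]
    · simp [MvPolynomial.X, MvPolynomial.monomial_mul]
  refine hsub.trans (Ideal.span_le.2 ?_)
  rintro _ ⟨a, ha, rfl⟩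
  obtain ⟨i, j, k, b, hi, hij, hjk, hk, rfl⟩ := exists_add_three_singles ha
  obtain ⟨c, hc⟩ := exists_columns (by omega) hi hij hjk hk
  have h2 : ((c 2 : ℕ) : K) ≠ 0 := by
    have : (c 0 : ℕ) < c 2 := c.strictMono (by decide)
    rw [Nat.cast_ne_zero]
    omega
  have e : (MvPolynomial.monomial (b + (single i 1 + single j 1 + single k 1)) 1 :
      MvPolynomial (Fin (d + 1)) K) = MvPolynomial.monomial b (-((c 2 : ℕ) : K)⁻¹) *
        mo.leadingTerm ((momentMatrix K d).submatrix id c).det := by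
    rw [h.leadingTerm_momentMinor, hc, MvPolynomial.monomial_mul, neg_mul_neg, inv_mul_cancel₀ h2]
  simp only [e]
  exact Ideal.mul_mem_left _ _ (Ideal.subset_span ⟨_, ⟨c, rfl⟩, rfl⟩)

end Main

theorem mainTheorem5 (K : Type*) [Field K] [CharZero K] (d : ℕ) (hd : 3 ≤ d)
    (e : Fin (d + 1) ≃ Fin (d + 1)) (he : e = Equiv.refl (Fin (d + 1)) ∨ e = Fin.revPerm) :
    (projIdeal (gaussianMomentVariety K d)).IsPrime ∧
    IsGroebnerBasis (degRevLex e) (momentMinors K d) (projIdeal (gaussianMomentVariety K d)) ∧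
    initialIdeal (degRevLex e) (projIdeal (gaussianMomentVariety K d)) =
      Ideal.span {f | ∃ i : Fin (d + 1), 1 ≤ (i : ℕ) ∧ (i : ℕ) ≤ d - 2 ∧
        f = MvPolynomial.X i} ^ 3 := by
  have h := isBalanced_degRevLex he
  have h1 := h.midIdeal_pow_le K hd
  have h2 : Ideal.span ((degRevLex e).leadingTerm '' momentMinors K d) ≤
      initialIdeal (degRevLex e) (projIdeal (gaussianMomentVariety K d)) :=
    Ideal.span_mono (Set.image_mono (momentMinors_subset K))
  have h3 := h.initialIdeal_le K hd
  -- The inclusions form a circle: the cube lies in the ideal of leading terms of the minors, that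
  -- in the initial ideal, and that in the cube.
  exact ⟨isPrime_projIdeal_gaussianMomentVariety K d,
    ⟨Set.finite_range _, momentMinors_subset K, le_antisymm h2 (h3.trans h1)⟩,
    le_antisymm h3 (h1.trans h2)⟩
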